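/- For a topological space $X$ let $\mathrm{Exp}(X)$ be the set of all finite subsets of $X$ (including $\emptyset$), a commutative idempotent monoid under union with unit $\emptyset$. For a finite set $\{U_i\}_{i\in I}$ of open subsets of $X$ (possibly $I=\emptyset$) put $$[U_i]_{i\in I}=\{S\in\mathrm{Exp}(X) : S\subseteq\textstyle\bigcup_{i\in I}U_i \text{ and } S\cap U_i\neq\emptyset \text{ for all } i\in I\}.$$ The metric exponential $\mathrm{Exp}_M(X)$ is $\mathrm{Exp}(X)$ with the coarsest topology for which all the sets $[U_i]_{i\in I}$ are open. The topological exponential $\mathrm{Exp}_T(X)$ is $\mathrm{Exp}(X)$ with the finest topology for which the maps $X^n\to\mathrm{Exp}(X)$, $(x_1,\dots,x_n)\mapsto\{x_1,\dots,x_n\}$, are continuous for all $n\ge 0$. Let $\mathbf I_2=(\{0,1\},\vee)$ be the idempotent commutative monoid with two elements, with the discrete topology, and give $\bigoplus_{\pi_0(X)}\mathbf I_2$ the colimit topology of the finite products $\prod_J \mathbf I_2$, $J\subseteq\pi_0(X)$ finite (this topology is discrete). Here $\pi_0(X)$ is the set of connected components of $X$. A weak homotopy equivalence is a continuous map that induces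 a bijection on path components and an isomorphism on $\pi_n$ for every $n\ge 1$ and every base point. **Theorem 2.24.** Let $X$ be a locally path connected topological space. The monoid map $$\exists:\mathrm{Exp}_M(X)\longrightarrow\bigoplus_{\pi_0(X)}\mathbf I_2$$ sending a finite subset $S\subseteq X$ to the family $(\exists_i)_{i\in\pi_0(X)}$ with $\exists_i=0$ if and only if no element of $S$ belongs to the connected component $X_i\subseteq X$, is continuous and a weak homotopy equivalence. Moreover, if $X$ is also Hausdorff, the same map $\exists:\mathrm{Exp}_T(X)\to\bigoplus_{\pi_0(X)}\mathbf I_2$ is continuous and a weak homotopy equivalence. -/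

import Mathlib

open Topology

noncomputable section

/-! ### Weak homotopy equivalences -/

section WeakEquiv

variable {Y Z : Type*} [TopologicalSpace Y] [TopologicalSpace Z]

/-- The map induced by a continuous map on sets of path components. -/
def zerothHomotopyMap (f : C(Y, Z)) : ZerothHomotopy Y → ZerothHomotopy Z :=
  ZerothHomotopy.lift (fun y => ZerothHomotopy.mk (f y))
    fun _ _ p => ZerothHomotopy.sound (p.map f.continuous)

/-- The map induced by a continuous map on `n`-dimensional generalized loops. -/
def genLoopMap (n : ℕ) (f : C(Y, Z)) (y : Y) (p : GenLoop (Fin n) Y y) :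
    GenLoop (Fin n) Z (f y) :=
  ⟨f.comp p.1, fun t ht => congrArg f (p.2 t ht)⟩

/-- The map `π_n(Y, y) → π_n(Z, f y)` induced by a continuous map `f`. -/
def homotopyGroupMap (n : ℕ) (f : C(Y, Z)) (y : Y) : π_ n Y y → π_ n Z (f y) :=
  Quotient.map (genLoopMap n f y) fun _ _ h => h.comp_continuousMap f

/-- A weak homotopy equivalence: a continuous map inducing a bijection on path components and,
for every `n ≥ 1` and every base point, a bijection (hence a group isomorphism) on `π_n`. -/
def IsWeakHomotopyEquiv (f : Y → Z) : Prop :=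
  ∃ hf : Continuous f,
    Function.Bijective (zerothHomotopyMap ⟨f, hf⟩) ∧
    ∀ n : ℕ, 1 ≤ n → ∀ y : Y, Function.Bijective (homotopyGroupMap n ⟨f, hf⟩ y)

end WeakEquiv

/-! ### The set of finite subsets, as an idempotent commutative monoid under union -/

/-- `Exp X` is the set of all finite subsets of `X`, the empty one included. -/
def FinExp (X : Type*) : Type _ := {S : Set X // S.Finite}

namespace FinExp

variable {X : Type*}

instance : Add (FinExp X) := ⟨fun S T => ⟨S.1 ∪ T.1, S.2.union T.2⟩⟩

instance : Zero (FinExp X) := ⟨⟨∅, Set.finite_empty⟩⟩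

/-- The commutative monoid of finite subsets: the operation is the union, the unit is `∅`. -/
instance : AddCommMonoid (FinExp X) where
  add_assoc S T R := Subtype.ext (Set.union_assoc S.1 T.1 R.1)
  zero_add S := Subtype.ext (Set.empty_union S.1)
  add_zero S := Subtype.ext (Set.union_empty S.1)
  add_comm S T := Subtype.ext (Set.union_comm S.1 T.1)
  nsmul := nsmulRec

/-- The finite subset `[x₁, …, xₙ]` represented by a tuple. -/
def ofTuple (n : ℕ) (v : Fin n → X) : FinExp X := ⟨Set.range v, Set.finite_range v⟩

/-- The set `[U_i]_{i ∈ I}` attached to a finite set of open subsets: a finite subset `S` belongs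
to it if and only if `S` is contained in the union of the `U_i` and meets each of them. -/
def bracket [TopologicalSpace X] (I : Finset (TopologicalSpace.Opens X)) : Set (FinExp X) :=
  {S | (∀ x ∈ S.1, ∃ U ∈ I, x ∈ U) ∧ ∀ U ∈ I, ∃ x ∈ S.1, x ∈ U}

end FinExp

/-- The metric exponential: finite subsets of `X`, with the coarsest topology in which all the
sets `[U_i]_{i ∈ I}`, for finite sets of open subsets of `X`, are open. -/
def ExpM (X : Type*) : Type _ := FinExp X

instance (X : Type*) : AddCommMonoid (ExpM X) := inferInstanceAs (AddCommMonoid (FinExp X))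

instance (X : Type*) [TopologicalSpace X] : TopologicalSpace (ExpM X) :=
  TopologicalSpace.generateFrom (Set.range (FinExp.bracket (X := X)))

/-- The topological exponential: finite subsets of `X`, with the finest topology for which all the
maps `X^n → Exp X`, `(x₁, …, xₙ) ↦ [x₁, …, xₙ]`, `n ≥ 0`, are continuous. -/
def ExpT (X : Type*) : Type _ := FinExp X

instance (X : Type*) : AddCommMonoid (ExpT X) := inferInstanceAs (AddCommMonoid (FinExp X))

instance (X : Type*) [TopologicalSpace X] : TopologicalSpace (ExpT X) :=
  ⨆ n : ℕ, TopologicalSpace.coinduced (FinExp.ofTuple (X := X) n) inferInstance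

/-! ### The discrete monoid `I₂` and its direct sums -/

/-- The commutative idempotent monoid `({0, 1}, ∨)`. -/
def I2 : Type := Bool

namespace I2

instance : DecidableEq I2 := inferInstanceAs (DecidableEq Bool)

instance : TopologicalSpace I2 := ⊥

instance : DiscreteTopology I2 := ⟨rfl⟩

instance : Add I2 := ⟨Bool.or⟩

instance : Zero I2 := ⟨Bool.false⟩

instance : AddCommMonoid I2 where
  add_assoc := Bool.or_assoc
  zero_add := Bool.false_or
  add_zero := Bool.or_false
  add_comm := Bool.or_comm
  nsmul := nsmulRec

instance : One I2 := ⟨Bool.true⟩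

theorem one_ne_zero : (1 : I2) ≠ 0 := Bool.noConfusion

theorem one_add_one : (1 : I2) + 1 = 1 := rfl

end I2

/-- The direct sum of copies of `I₂` indexed by `ι`. -/
def DirectSumI2 (ι : Type*) : Type _ := ι →₀ I2

namespace DirectSumI2

variable {ι : Type*}

instance : AddCommMonoid (DirectSumI2 ι) := inferInstanceAs (AddCommMonoid (ι →₀ I2))

instance : FunLike (DirectSumI2 ι) ι I2 := inferInstanceAs (FunLike (ι →₀ I2) ι I2)

open Classical in
/-- The inclusion of the product over a finite subset of the index set: extension by zero. -/
def ofFinite (J : Finset ι) (v : J → I2) : DirectSumI2 ι :=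
  Finsupp.onFinset J (fun i => if h : i ∈ J then v ⟨i, h⟩ else 0) fun i hi => by
    by_contra h
    exact hi (dif_neg h)

/-- The direct sum is the colimit of the products over the finite subsets of the index set,
each with the product topology. -/
instance : TopologicalSpace (DirectSumI2 ι) :=
  ⨆ J : Finset ι, TopologicalSpace.coinduced (ofFinite J) inferInstance

/-- This topology is discrete. -/
instance : DiscreteTopology (DirectSumI2 ι) := ⟨by
  refine le_bot_iff.mp (iSup_le fun J => ?_)
  rw [← continuous_iff_coinduced_le]
  exact @continuous_of_discreteTopology _ _ _ _ ⊥ _⟩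

end DirectSumI2

/-! ### The map recording which connected components are met -/

section ExistsMap

variable (X : Type*) [TopologicalSpace X]

open Classical in
/-- The monoid map `∃` sending a finite subset `S` of `X` to the family indexed by the connected
components of `X`, whose value at a component is `1` if this component contains an element of `S`
and `0` otherwise. -/
def existsHom : FinExp X →+ DirectSumI2 (ConnectedComponents X) where
  toFun S := Finsupp.onFinset (S.2.image ConnectedComponents.mk).toFinset
    (fun c => if ∃ x ∈ S.1, ConnectedComponents.mk x = c then 1 else 0) fun c hc => by
      rw [Set.Finite.mem_toFinset]
      by_contra h
      exact hc (if_neg h)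
  map_zero' := Finsupp.ext fun c => if_neg fun ⟨_, hx, _⟩ => hx
  map_add' S T := Finsupp.ext fun c => by
    change (if ∃ x ∈ S.1 ∪ T.1, ConnectedComponents.mk x = c then (1 : I2) else 0) =
      (if ∃ x ∈ S.1, ConnectedComponents.mk x = c then (1 : I2) else 0) +
      (if ∃ x ∈ T.1, ConnectedComponents.mk x = c then (1 : I2) else 0)
    by_cases hS : ∃ x ∈ S.1, ConnectedComponents.mk x = c <;>
    by_cases hT : ∃ x ∈ T.1, ConnectedComponents.mk x = c <;>
    simp only [Set.mem_union, or_and_right, exists_or, hS, hT, or_self, or_true, or_false,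
      if_true, if_false, add_zero, zero_add, I2.one_add_one]

/-- The map `∃` vanishes at a component exactly when no element of `S` belongs to it. -/
theorem existsHom_apply_eq_zero_iff (S : FinExp X) (c : ConnectedComponents X) :
    existsHom X S c = 0 ↔ ∀ x ∈ S.1, ConnectedComponents.mk x ≠ c := by
  classical
  change (if ∃ x ∈ S.1, ConnectedComponents.mk x = c then (1 : I2) else 0) = 0 ↔ _
  by_cases h : ∃ x ∈ S.1, ConnectedComponents.mk x = c
  · rw [if_pos h]
    exact ⟨fun h' => absurd h' I2.one_ne_zero, fun h' => absurd h (by simpa using h')⟩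
  · rw [if_neg h]
    simpa using h

/-- The map `∃` on the metric exponential. -/
def existsM : ExpM X →+ DirectSumI2 (ConnectedComponents X) := existsHom X

/-- The map `∃` on the topological exponential. -/
def existsT : ExpT X →+ DirectSumI2 (ConnectedComponents X) := existsHom X

end ExistsMap

end

/-!
The target of `∃` is discrete, so `∃` is a weak homotopy equivalence as soon as it is continuous and
surjective, any two finite sets with the same image are joined by a path, and all higher homotopy
groups of the source vanish.

The homotopy groups vanish because the union is idempotent
(`HomotopyGroup.subsingleton_of_idempotent`): by the interchange law, the operation that the union
induces on `π_n` is determined by the group law and by the endomorphism induced by adding the base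
point, and idempotence then forces every class to be trivial. The base point need not be the unit of
the monoid, so this handles every component at once. It only requires the pointwise union of two
continuous maps from a compact space to be continuous. On the metric exponential the union is even
jointly continuous (`ExpM.continuous_add`). On the topological exponential of a Hausdorff space,
a compact family has bounded cardinality (`ExpT.exists_ncard_le`), and on the finite subsets of
bounded cardinality the two topologies agree (`ExpT.exists_bracket_subset`), which reduces the claim
to the metric case.

The components of a locally path connected space are open and path connected. By openness, the
fibres of `∃` are open, being sets `[X_i]_{i ∈ J}` of components. By path connectedness, a finite
set `S` can be joined to `S ∪ T` by moving copies of points of `S` to the points of `T`, if `T` only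
meets components that `S` meets (`ExpT.joined_add`); if `S` and `T` have the same image, both are
thus joined to `S ∪ T`.
-/

/-! ### Homotopy groups of idempotent semigroups -/

section Idempotent

/-- The addition of `E` is continuous along pairs of maps from compact spaces: the pointwise sum of
two continuous maps from a compact space to `E` is continuous. This is weaker than
`ContinuousAdd E`, and it is all that homotopy groups see of the addition. -/
def CompactlyContinuousAdd (E : Type*) [TopologicalSpace E] [Add E] : Prop :=
  ∀ (K : Type) [TopologicalSpace K] [CompactSpace K] (f g : K → E),
    Continuous f → Continuous g → Continuous fun t => f t + g t

variable {N : Type} {E : Type*} [TopologicalSpace E] [AddCommSemigroup E] {e : E}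

/-- The pointwise sum of two generalized loops based at an idempotent point. -/
def GenLoop.pointwiseAdd (hE : CompactlyContinuousAdd E) (he : e + e = e) (p q : GenLoop N E e) :
    GenLoop N E e :=
  ⟨⟨fun t => p t + q t, hE _ _ _ p.1.continuous q.1.continuous⟩, fun t ht => by
    change p t + q t = e
    rw [GenLoop.boundary p t ht, GenLoop.boundary q t ht, he]⟩

/-- The operation induced on homotopy classes by the pointwise sum of generalized loops. -/
def HomotopyGroup.pointwiseAdd (hE : CompactlyContinuousAdd E) (he : e + e = e) :
    HomotopyGroup N E e → HomotopyGroup N E e → HomotopyGroup N E e :=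
  Quotient.map₂ (GenLoop.pointwiseAdd hE he) <| by
    rintro p p' ⟨F⟩ q q' ⟨G⟩
    refine ⟨⟨⟨⟨fun t => F t + G t, hE _ _ _ F.continuous G.continuous⟩, fun t => ?_, fun t => ?_⟩,
      fun s t ht => ?_⟩⟩
    · change F (0, t) + G (0, t) = p t + q t
      rw [F.apply_zero, G.apply_zero]; rfl
    · change F (1, t) + G (1, t) = p' t + q' t
      rw [F.apply_one, G.apply_one]; rfl
    · change F (s, t) + G (s, t) = p t + q t
      rw [F.eq_fst s ht, G.eq_fst s ht]; rfl

/-- The interchange law between concatenation and the pointwise sum. -/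
theorem HomotopyGroup.pointwiseAdd_mul [DecidableEq N] [Nonempty N]
    (hE : CompactlyContinuousAdd E) (he : e + e = e) (x y z w : HomotopyGroup N E e) :
    pointwiseAdd hE he (x * y) (z * w) = pointwiseAdd hE he x z * pointwiseAdd hE he y w := by
  let i : N := Classical.arbitrary N
  let cl : GenLoop N E e → HomotopyGroup N E e := fun p => Quotient.mk _ p
  have cl_mul (a b) : cl a * cl b = cl (GenLoop.transAt i b a) := HomotopyGroup.mul_spec
  have cl_add (a b) : pointwiseAdd hE he (cl a) (cl b) = cl (GenLoop.pointwiseAdd hE he a b) := rfl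
  obtain ⟨p, rfl⟩ : ∃ p, cl p = x := Quotient.exists_rep x
  obtain ⟨q, rfl⟩ : ∃ q, cl q = y := Quotient.exists_rep y
  obtain ⟨r, rfl⟩ : ∃ r, cl r = z := Quotient.exists_rep z
  obtain ⟨s, rfl⟩ : ∃ s, cl s = w := Quotient.exists_rep w
  rw [cl_mul, cl_mul, cl_add, cl_add, cl_add, cl_mul]
  refine congrArg cl (GenLoop.ext _ _ fun t => ?_)
  change GenLoop.transAt i q p t + GenLoop.transAt i s r t = _
  simp only [GenLoop.transAt, GenLoop.coe_copy]
  split_ifs <;> rfl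

/-- The homotopy groups of a commutative idempotent semigroup are trivial. Adding the base point
induces an idempotent endomorphism `φ` of the homotopy group, and the interchange law turns the
idempotence `x + x = x` into `φ x * φ x = x`; hence `φ x = φ (φ x) * φ (φ x) = φ x * φ x`, so that
`φ x = 1` and `x = 1`. -/
theorem HomotopyGroup.subsingleton_of_idempotent [Nonempty N]
    (hE : CompactlyContinuousAdd E) (idem : ∀ a : E, a + a = a) (e : E) :
    Subsingleton (HomotopyGroup N E e) := by
  classical
  let M := pointwiseAdd (N := N) hE (idem e)
  have M_comm (x y) : M x y = M y x := by
    induction x using Quotient.inductionOn with | _ p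
    induction y using Quotient.inductionOn with | _ q
    exact congrArg _ (GenLoop.ext _ _ fun t => add_comm (p t) (q t))
  have M_self (x) : M x x = x := by
    induction x using Quotient.inductionOn with | _ p
    exact congrArg _ (GenLoop.ext _ _ fun t => idem (p t))
  have M_one_one (x) : M (M x 1) 1 = M x 1 := by
    induction x using Quotient.inductionOn with | _ p
    refine congrArg _ (GenLoop.ext (GenLoop.pointwiseAdd hE (idem e)
      (GenLoop.pointwiseAdd hE (idem e) p GenLoop.const) GenLoop.const)
      (GenLoop.pointwiseAdd hE (idem e) p GenLoop.const) fun t => ?_)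
    change p t + e + e = p t + e
    rw [add_assoc, idem]
  have sq (x) : M x 1 * M x 1 = x := by
    conv_rhs => rw [← M_self x]
    calc M x 1 * M x 1 = M x 1 * M 1 x := by rw [M_comm 1 x]
      _ = M (x * 1) (1 * x) := (pointwiseAdd_mul hE (idem e) x 1 1 x).symm
      _ = M x x := by rw [mul_one, one_mul]
  have M_one (x) : M x 1 = 1 := by
    have h := sq (M x 1)
    rw [M_one_one] at h
    exact mul_eq_left.mp h
  refine ⟨fun x y => ?_⟩
  rw [← sq x, ← sq y, M_one, M_one]

end Idempotent

/-! ### Weak homotopy equivalences to discrete spaces -/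

section Discrete

theorem eq_of_joined_of_discrete {Z : Type*} [TopologicalSpace Z] [DiscreteTopology Z] {a b : Z}
    (h : Joined a b) : a = b := by
  obtain ⟨p⟩ := h
  simpa using PreconnectedSpace.constant inferInstance p.continuous (x := 0) (y := 1)

theorem subsingleton_homotopyGroup_of_discrete {N Z : Type*} [Nonempty N] [TopologicalSpace Z]
    [DiscreteTopology Z] (z : Z) : Subsingleton (HomotopyGroup N Z z) := by
  have const (p : GenLoop N Z z) (t) : p t = z :=
    (PreconnectedSpace.constant inferInstance p.1.continuous (x := t) (y := 0)).trans
      (p.2 0 ⟨Classical.arbitrary N, Or.inl rfl⟩)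
  have : Subsingleton (GenLoop N Z z) :=
    ⟨fun p q => GenLoop.ext p q fun t => (const p t).trans (const q t).symm⟩
  exact Quotient.instSubsingletonQuotient _

theorem isWeakHomotopyEquiv_of_discrete {Y Z : Type*} [TopologicalSpace Y] [TopologicalSpace Z]
    [DiscreteTopology Z] {f : Y → Z} (hf : Continuous f) (surj : Function.Surjective f)
    (joined : ∀ y y', f y = f y' → Joined y y')
    (htriv : ∀ n : ℕ, 1 ≤ n → ∀ y : Y, Subsingleton (π_ n Y y)) :
    IsWeakHomotopyEquiv f := by
  refine ⟨hf, ⟨fun a b hab => ?_, fun c => ?_⟩, fun n hn y => ⟨fun a b _ => ?_, fun c => ?_⟩⟩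
  · obtain ⟨y, rfl⟩ := ZerothHomotopy.mk_surjective a
    obtain ⟨y', rfl⟩ := ZerothHomotopy.mk_surjective b
    exact Quotient.sound (joined y y' (eq_of_joined_of_discrete (Quotient.exact hab)))
  · obtain ⟨z, rfl⟩ := ZerothHomotopy.mk_surjective c
    obtain ⟨y, rfl⟩ := surj z
    exact ⟨ZerothHomotopy.mk y, rfl⟩
  · exact (htriv n hn y).elim a b
  · have : Nonempty (Fin n) := ⟨⟨0, hn⟩⟩
    exact ⟨default, (subsingleton_homotopyGroup_of_discrete (f y)).elim _ _⟩

end Discrete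

/-! ### The metric exponential -/

section Metric

variable {X : Type*} [TopologicalSpace X]

theorem FinExp.ofTuple_mem_bracket {n : ℕ} {v : Fin n → X}
    {I : Finset (TopologicalSpace.Opens X)} :
    FinExp.ofTuple n v ∈ FinExp.bracket I ↔
      (∀ i, ∃ U ∈ I, v i ∈ U) ∧ ∀ U ∈ I, ∃ i, v i ∈ U :=
  and_congr Set.forall_mem_range (forall₂_congr fun _ _ => Set.exists_range_iff)

theorem ExpM.isOpen_bracket (I : Finset (TopologicalSpace.Opens X)) :
    IsOpen (X := ExpM X) (FinExp.bracket I) :=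
  TopologicalSpace.isOpen_generateFrom_of_mem ⟨I, rfl⟩

theorem ExpM.continuous_ofTuple (n : ℕ) : Continuous (Y := ExpM X) (FinExp.ofTuple (X := X) n) := by
  refine continuous_generateFrom_iff.mpr ?_
  rintro _ ⟨I, rfl⟩
  have : FinExp.ofTuple (X := X) n ⁻¹' FinExp.bracket I =
      (⋂ i, ⋃ U ∈ I, {v | v i ∈ U}) ∩ ⋂ U ∈ I, ⋃ i, {v | v i ∈ U} := by
    ext v
    simp only [Set.mem_preimage, FinExp.ofTuple_mem_bracket, Set.mem_inter_iff, Set.mem_iInter,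
      Set.mem_iUnion, Set.mem_ofPred_eq, exists_prop]
  refine (congrArg IsOpen this).mpr (IsOpen.inter
    (isOpen_iInter_of_finite fun i => isOpen_biUnion fun U _ => ?_)
    (isOpen_biInter_finset fun U _ => isOpen_iUnion fun i => ?_)) <;>
  exact U.isOpen.preimage (continuous_apply i)

/-- The union is jointly continuous on the metric exponential: if `S ∪ T` lies in `[U_i]_{i ∈ I}`,
then every `S' ∪ T'` does, as soon as `S'` and `T'` lie in the brackets of those `U_i` that `S`,
respectively `T`, meets. -/
theorem ExpM.continuous_add : Continuous fun p : ExpM X × ExpM X => p.1 + p.2 := by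
  classical
  refine continuous_generateFrom_iff.mpr ?_
  rintro _ ⟨I, rfl⟩
  refine isOpen_iff_forall_mem_open.mpr ?_
  rintro ⟨S, T⟩ ⟨hsub, hmeet⟩
  let A (R : ExpM X) := I.filter fun U => ∃ x ∈ R.1, x ∈ U
  have mem_A (R : ExpM X) (hR : ∀ x ∈ R.1, ∃ U ∈ I, x ∈ U) : R ∈ FinExp.bracket (A R) := by
    refine ⟨fun x hx => ?_, fun U hU => (Finset.mem_filter.mp hU).2⟩
    obtain ⟨U, hU, hxU⟩ := hR x hx
    exact ⟨U, Finset.mem_filter.mpr ⟨hU, x, hx, hxU⟩, hxU⟩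
  refine ⟨(FinExp.bracket (A S) : Set (ExpM X)) ×ˢ (FinExp.bracket (A T) : Set (ExpM X)), ?_,
    IsOpen.prod (X := ExpM X) (Y := ExpM X) (ExpM.isOpen_bracket _) (ExpM.isOpen_bracket _),
    mem_A S fun x hx => hsub x (Or.inl hx), mem_A T fun x hx => hsub x (Or.inr hx)⟩
  rintro ⟨S', T'⟩ ⟨⟨hS, hS'⟩, ⟨hT, hT'⟩⟩
  refine ⟨?_, fun U hU => ?_⟩
  · rintro x (hx | hx)
    · obtain ⟨U, hU, hxU⟩ := hS x hx
      exact ⟨U, (Finset.mem_filter.mp hU).1, hxU⟩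
    · obtain ⟨U, hU, hxU⟩ := hT x hx
      exact ⟨U, (Finset.mem_filter.mp hU).1, hxU⟩
  · obtain ⟨x, hx | hx, hxU⟩ := hmeet U hU
    · obtain ⟨y, hy, hyU⟩ := hS' U (Finset.mem_filter.mpr ⟨hU, x, hx, hxU⟩)
      exact ⟨y, Or.inl hy, hyU⟩
    · obtain ⟨y, hy, hyU⟩ := hT' U (Finset.mem_filter.mpr ⟨hU, x, hx, hxU⟩)
      exact ⟨y, Or.inr hy, hyU⟩

theorem ExpM.compactlyContinuousAdd : CompactlyContinuousAdd (ExpM X) :=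
  fun _ _ _ _ _ hf hg => ExpM.continuous_add.comp (hf.prodMk hg)

end Metric

/-! ### The topological exponential -/

section Topological

variable {X : Type*}

/-- The identity map from the topological to the metric exponential. -/
def ExpT.toExpM (S : ExpT X) : ExpM X := S

theorem FinExp.exists_ofTuple_eq {T : FinExp X} (hT : T.1.Nonempty) {n : ℕ} (hn : T.1.ncard ≤ n) :
    ∃ w, FinExp.ofTuple n w = T := by
  have := T.2.to_subtype
  have := hT.to_subtype
  let g : T.1 → Fin n := fun x => Fin.castLE hn (Finite.equivFin T.1 x)
  have hg : Function.Injective g := (Fin.castLE_injective hn).comp (Finite.equivFin T.1).injective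
  refine ⟨fun i => (Function.invFun g i).1, Subtype.ext (Set.Subset.antisymm ?_ fun x hx => ?_)⟩
  · rintro _ ⟨i, rfl⟩
    exact (Function.invFun g i).2
  · obtain ⟨i, hi⟩ := Function.invFun_surjective hg ⟨x, hx⟩
    exact ⟨i, congrArg Subtype.val hi⟩

theorem FinExp.finite_ofTuple_fiber (n : ℕ) (S : FinExp X) :
    {v | FinExp.ofTuple n v = S}.Finite := by
  refine (Set.Finite.pi' fun _ => S.2).subset ?_
  rintro v rfl i
  exact ⟨i, rfl⟩

variable [TopologicalSpace X]

theorem ExpT.continuous_ofTuple (n : ℕ) : Continuous (Y := ExpT X) (FinExp.ofTuple (X := X) n) :=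
  continuous_iff_coinduced_le.mpr
    (le_iSup (fun n => TopologicalSpace.coinduced (FinExp.ofTuple (X := X) n) inferInstance) n)

theorem ExpT.continuous_toExpM : Continuous (ExpT.toExpM (X := X)) :=
  continuous_iSup_dom.mpr fun n => continuous_coinduced_dom.mpr (ExpM.continuous_ofTuple n)

/-- In a Hausdorff space, the metric and the topological exponentials induce the same topology on
the finite subsets with at most `n` elements: there, the neighbourhoods of a point in the
topological exponential contain brackets. -/
theorem ExpT.exists_bracket_subset [T2Space X] {O : Set (ExpT X)} (hO : IsOpen O) {S : ExpT X}
    (hS : S ∈ O) (n : ℕ) : ∃ I : Finset (TopologicalSpace.Opens X),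
      S ∈ FinExp.bracket I ∧ ∀ T ∈ FinExp.bracket I, T.1.ncard ≤ n → T ∈ O := by
  classical
  obtain ⟨U, hU, disj⟩ := S.2.t2_separation
  have hV := FinExp.finite_ofTuple_fiber n S
  have hP := hO.preimage (ExpT.continuous_ofTuple n)
  have box (v : Fin n → X) (hv : FinExp.ofTuple n v = S) : ∃ W : Fin n → Set X,
      (∀ i, IsOpen (W i) ∧ v i ∈ W i) ∧ Set.univ.pi W ⊆ FinExp.ofTuple n ⁻¹' O :=
    isOpen_pi_iff'.mp hP v (hv.symm ▸ hS : FinExp.ofTuple n v ∈ O)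
  choose! W hW hWO using box
  -- `U' x` is so small that, for every tuple `v` with image `S`, the box around `v` with
  -- sides `U' (v i)` is sent to `O`.
  let U' (x : X) : Set X := U x ∩ ⋂ v ∈ {v | FinExp.ofTuple n v = S}, ⋂ i, {y | v i = x → y ∈ W v i}
  have hU'mem (x) : x ∈ U' x := by
    refine ⟨(hU x).1, Set.mem_iInter₂.mpr fun v hv => Set.mem_iInter.mpr fun i => ?_⟩
    rintro rfl
    exact (hW v hv i).2
  have hU'open (x) : IsOpen (U' x) := by
    refine (hU x).2.inter (hV.isOpen_biInter fun v hv => isOpen_iInter_of_finite fun i => ?_)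
    by_cases h : v i = x
    · simpa [h] using (hW v hv i).1
    · simp [h]
  refine ⟨S.2.toFinset.image fun x => ⟨U' x, hU'open x⟩, ⟨fun x hx => ?_, ?_⟩, ?_⟩
  · exact ⟨_, Finset.mem_image_of_mem _ (S.2.mem_toFinset.mpr hx), hU'mem x⟩
  · intro V hV
    obtain ⟨x, hx, rfl⟩ := Finset.mem_image.mp hV
    exact ⟨x, S.2.mem_toFinset.mp hx, hU'mem x⟩
  rintro T ⟨hsub, hmeet⟩ hcard
  replace hsub (x) (hx : x ∈ T.1) : ∃ y ∈ S.1, x ∈ U' y := by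
    obtain ⟨V, hV, hxV⟩ := hsub x hx
    obtain ⟨y, hy, rfl⟩ := Finset.mem_image.mp hV
    exact ⟨y, S.2.mem_toFinset.mp hy, hxV⟩
  replace hmeet (y) (hy : y ∈ S.1) : ∃ x ∈ T.1, x ∈ U' y :=
    hmeet _ (Finset.mem_image_of_mem _ (S.2.mem_toFinset.mpr hy))
  obtain hT | hT := T.1.eq_empty_or_nonempty
  · have : T = S := Subtype.ext <| hT.trans <| Eq.symm <| Set.eq_empty_iff_forall_notMem.mpr
      fun y hy => by
        obtain ⟨x, hx, -⟩ := hmeet y hy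
        rw [hT] at hx
        exact hx
    rwa [this]
  · obtain ⟨w, rfl⟩ := FinExp.exists_ofTuple_eq hT hcard
    choose v hvS hvU using fun i => hsub (w i) ⟨i, rfl⟩
    -- By disjointness, the tuple `v` of points of `S` close to the points of `w` exhausts `S`.
    have hv : FinExp.ofTuple n v = S := by
      refine Subtype.ext (Set.Subset.antisymm (Set.range_subset_iff.mpr hvS) fun y hy => ?_)
      obtain ⟨_, ⟨i, rfl⟩, hi⟩ := hmeet y hy
      by_contra hne
      exact Set.disjoint_left.mp (disj (hvS i) hy fun h => hne ⟨i, h⟩) (hvU i).1 hi.1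
    exact hWO v hv fun i _ => Set.mem_iInter.mp (Set.mem_iInter₂.mp (hvU i).2 v hv) i rfl

theorem ExpT.continuous_of_ncard_le [T2Space X] {K : Type*} [TopologicalSpace K] {f : K → ExpT X}
    (hf : Continuous fun t => (f t).toExpM) {n : ℕ} (hn : ∀ t, (f t).1.ncard ≤ n) :
    Continuous f := by
  refine continuous_def.mpr fun O hO => isOpen_iff_forall_mem_open.mpr fun t ht => ?_
  obtain ⟨I, hI, hsub⟩ := ExpT.exists_bracket_subset hO ht n
  exact ⟨_, fun s hs => hsub (f s) hs (hn s), (ExpM.isOpen_bracket I).preimage hf, hI⟩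

/-- A compact family in the topological exponential of a `T₁` space has bounded cardinality:
a set containing only finitely many finite subsets of each cardinality is closed, so that a
sequence of unbounded cardinality would have no cluster point. -/
theorem ExpT.exists_ncard_le [T1Space X] {K : Type*} [TopologicalSpace K] [CompactSpace K]
    {f : K → ExpT X} (hf : Continuous f) : ∃ n, ∀ t, (f t).1.ncard ≤ n := by
  by_contra! h
  choose t ht using h
  let C (n : ℕ) : Set (ExpT X) := {S | ∃ k, n ≤ k ∧ S = f (t k)}
  have hC (n) : IsClosed (C n) := by
    refine isClosed_iSup_iff.mpr fun m => isClosed_coinduced.mpr (Set.Finite.isClosed ?_)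
    refine ((Set.finite_lt_nat m).biUnion fun k _ =>
      FinExp.finite_ofTuple_fiber m (f (t k))).subset ?_
    rintro v ⟨k, -, hk⟩
    refine Set.mem_biUnion (x := k) ?_ hk
    have hlt := ht k
    rw [← hk] at hlt
    refine hlt.trans_le ?_
    change (Set.range v).ncard ≤ m
    rw [← Set.image_univ]
    exact (Set.ncard_image_le Set.finite_univ).trans (by simp)
  obtain ⟨s, hs⟩ := IsCompact.nonempty_iInter_of_sequence_nonempty_isCompact_isClosed
    (fun n => f ⁻¹' C n) (fun n s ⟨k, hk, h⟩ => ⟨k, n.le_succ.trans hk, h⟩)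
    (fun n => ⟨t n, n, le_rfl, rfl⟩) ((hC 0).preimage hf).isCompact fun n => (hC n).preimage hf
  obtain ⟨k, hk, h⟩ := Set.mem_iInter.mp hs (f s).1.ncard
  have hlt := ht k
  rw [← h] at hlt
  exact absurd hlt hk.not_gt

theorem ExpT.compactlyContinuousAdd [T2Space X] : CompactlyContinuousAdd (ExpT X) := by
  intro K _ _ f g hf hg
  obtain ⟨m, hm⟩ := ExpT.exists_ncard_le hf
  obtain ⟨n, hn⟩ := ExpT.exists_ncard_le hg
  refine ExpT.continuous_of_ncard_le (n := m + n) ?_ fun t =>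
    (Set.ncard_union_le _ _).trans (add_le_add (hm t) (hn t))
  exact ExpM.continuous_add.comp
    ((ExpT.continuous_toExpM.comp hf).prodMk (ExpT.continuous_toExpM.comp hg))

end Topological

/-! ### The fibres of the map to the direct sum -/

section ExistsMap

variable {X : Type*} [TopologicalSpace X]

theorem DirectSumI2.ext_of_zero_iff {ι : Type*} {a b : DirectSumI2 ι}
    (h : ∀ i, a i = 0 ↔ b i = 0) : a = b := by
  have eq_of_zero_iff : ∀ u v : I2, (u = 0 ↔ v = 0) → u = v := by
    rintro (_ | _) (_ | _) huv
    · rfl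
    · exact (huv.mp rfl).symm
    · exact huv.mpr rfl
    · rfl
  exact DFunLike.ext _ _ fun i => eq_of_zero_iff _ _ (h i)

theorem existsHom_eq_iff {S T : FinExp X} : existsHom X S = existsHom X T ↔
    (ConnectedComponents.mk '' S.1 : Set (ConnectedComponents X)) =
      ConnectedComponents.mk '' T.1 := by
  have key (R : FinExp X) (c) : existsHom X R c = 0 ↔ c ∉ ConnectedComponents.mk '' R.1 := by
    rw [existsHom_apply_eq_zero_iff]
    simp
  refine ⟨fun h => Set.ext fun c => ?_, fun h => DirectSumI2.ext_of_zero_iff fun c => ?_⟩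
  · rw [← not_iff_not, ← key, ← key, h]
  · rw [key, key, h]

theorem existsHom_surjective : Function.Surjective (existsHom X) := by
  intro b
  choose rep hrep using ConnectedComponents.surjective_coe (α := X)
  have hb : {c | b c ≠ 0}.Finite := Finsupp.hasFiniteSupport (M := I2) b
  refine ⟨⟨rep '' {c | b c ≠ 0}, hb.image _⟩, DirectSumI2.ext_of_zero_iff fun c => ?_⟩
  refine (existsHom_apply_eq_zero_iff X _ c).trans ?_
  constructor
  · intro h
    by_contra hc
    exact h _ ⟨c, hc, rfl⟩ (hrep c)
  · rintro h _ ⟨c', hc', rfl⟩ rfl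
    exact hc' (hrep c' ▸ h)

theorem continuous_existsM [LocallyConnectedSpace X] : Continuous (existsM X) := by
  classical
  refine continuous_discrete_rng.mpr fun b => isOpen_iff_forall_mem_open.mpr fun S hS => ?_
  let comp (x : X) : TopologicalSpace.Opens X := ⟨connectedComponent x, isOpen_connectedComponent⟩
  refine ⟨FinExp.bracket (S.2.toFinset.image comp), fun T hT => ?_, ExpM.isOpen_bracket _,
    fun x hx => ⟨comp x, Finset.mem_image_of_mem _ (S.2.mem_toFinset.mpr hx),
      mem_connectedComponent⟩, fun U hU => ?_⟩
  · obtain rfl : existsHom X S = b := hS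
    obtain ⟨hsub, hmeet⟩ := hT
    refine existsHom_eq_iff.mpr (Set.Subset.antisymm ?_ ?_)
    · rintro _ ⟨x, hx, rfl⟩
      obtain ⟨U, hU, hxU⟩ := hsub x hx
      obtain ⟨y, hy, rfl⟩ := Finset.mem_image.mp hU
      exact ⟨y, S.2.mem_toFinset.mp hy,
        ConnectedComponents.coe_eq_coe.mpr (connectedComponent_eq hxU)⟩
    · rintro _ ⟨y, hy, rfl⟩
      obtain ⟨x, hx, hxy⟩ :=
        hmeet (comp y) (Finset.mem_image_of_mem _ (S.2.mem_toFinset.mpr hy))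
      exact ⟨x, hx, ConnectedComponents.coe_eq_coe.mpr (connectedComponent_eq hxy).symm⟩
  · obtain ⟨x, hx, rfl⟩ := Finset.mem_image.mp hU
    exact ⟨x, S.2.mem_toFinset.mp hx, mem_connectedComponent⟩

/-- A point `y` joined to a point of `S` can be added to `S` along a path: the path from that point
to `y` moves one coordinate of a tuple. -/
theorem ExpT.joined_insert {S : ExpT X} {x y : X} (hx : x ∈ S.1) (h : Joined x y) :
    Joined S (⟨insert y S.1, S.2.insert y⟩ : ExpT X) := by
  obtain ⟨γ⟩ := h
  obtain ⟨w, hw⟩ := FinExp.exists_ofTuple_eq ⟨x, hx⟩ (le_refl S.1.ncard)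
  have range_cons (z : X) : (FinExp.ofTuple _ (Fin.cons z w : Fin (S.1.ncard + 1) → X)).1 =
      insert z S.1 := by
    exact (Fin.range_cons z w).trans (congrArg (insert z) (congrArg Subtype.val hw))
  refine ⟨⟨⟨fun t => FinExp.ofTuple _ (Fin.cons (γ t) w : Fin (S.1.ncard + 1) → X),
    (ExpT.continuous_ofTuple _).comp ?_⟩, Subtype.ext ?_, Subtype.ext ?_⟩⟩
  · refine continuous_pi fun i => ?_
    induction i using Fin.cases with
    | zero => exact γ.continuous
    | succ i => exact continuous_const
  · refine (range_cons _).trans ?_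
    rw [γ.source, Set.insert_eq_of_mem hx]
  · refine (range_cons _).trans ?_
    rw [γ.target]

theorem ExpT.joined_add [LocallyPathConnectedSpace X] {S T : ExpT X}
    (h : (ConnectedComponents.mk '' T.1 : Set (ConnectedComponents X)) ⊆
      ConnectedComponents.mk '' S.1) : Joined S (S + T) := by
  let mk (A : Set X) (hA : A.Finite) : ExpT X := ⟨A, hA⟩
  obtain ⟨T, hT⟩ := T
  change Joined S (S + mk T hT)
  induction T, hT using Set.Finite.induction_on with
  | empty =>
    rw [show S + mk ∅ Set.finite_empty = S from add_zero S]
  | @insert y T _ hT ih =>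
    refine (ih ((Set.image_mono (Set.subset_insert y T)).trans h)).trans ?_
    obtain ⟨x, hx, hxy⟩ := h ⟨y, Set.mem_insert y T, rfl⟩
    have hins : S + mk (insert y T) (hT.insert y) =
        mk (insert y (S + mk T hT).1) ((S + mk T hT).2.insert y) :=
      Subtype.ext (p := Set.Finite) Set.union_insert
    rw [hins]
    exact ExpT.joined_insert (S := S + mk T hT) (Or.inl hx)
      ((connectedComponent_eq_iff_joined x y).mp (ConnectedComponents.coe_eq_coe.mp hxy))

theorem ExpT.joined_of_existsT_eq [LocallyPathConnectedSpace X] {S T : ExpT X}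
    (h : existsT X S = existsT X T) : Joined S T := by
  have himage := existsHom_eq_iff.mp h
  refine (ExpT.joined_add himage.symm.subset).trans ?_
  rw [add_comm]
  exact (ExpT.joined_add himage.subset).symm

end ExistsMap

/-- Let `X` be locally path connected. The monoid map `∃ : Exp_M(X) → ⨁_{π₀(X)} I₂` is continuous
and a weak homotopy equivalence; if `X` is Hausdorff, then so is `∃ : Exp_T(X) → ⨁_{π₀(X)} I₂`. -/
theorem theorem2p24 (X : Type*) [TopologicalSpace X] [LocallyPathConnectedSpace X] :
    (Continuous (existsM X) ∧ IsWeakHomotopyEquiv (existsM X)) ∧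
      (T2Space X → Continuous (existsT X) ∧ IsWeakHomotopyEquiv (existsT X)) :=
 by
  have hM : Continuous (existsM X) := continuous_existsM
  refine ⟨⟨hM, isWeakHomotopyEquiv_of_discrete hM existsHom_surjective (fun S T h => ?_)
    fun n hn S => ?_⟩, fun _ => ?_⟩
  · obtain ⟨γ⟩ := ExpT.joined_of_existsT_eq (S := S) (T := T) h
    exact ⟨γ.map ExpT.continuous_toExpM⟩
  · have : Nonempty (Fin n) := ⟨⟨0, hn⟩⟩
    exact HomotopyGroup.subsingleton_of_idempotent ExpM.compactlyContinuousAdd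
      (fun T => Subtype.ext (Set.union_self T.1)) S
  · have hT : Continuous (existsT X) := hM.comp ExpT.continuous_toExpM
    refine ⟨hT, isWeakHomotopyEquiv_of_discrete hT existsHom_surjective
      (fun _ _ => ExpT.joined_of_existsT_eq) fun n hn S => ?_⟩
    have : Nonempty (Fin n) := ⟨⟨0, hn⟩⟩
    exact HomotopyGroup.subsingleton_of_idempotent ExpT.compactlyContinuousAdd
      (fun T => Subtype.ext (Set.union_self T.1)) S
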